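/- **Local convergence with inexact unstable directions.** Let $f:\mathbb{R}^d\to\mathbb{R}$ and $c_1,\dots,c_m:\mathbb{R}^d\to\mathbb{R}$ be smooth, let $\mathcal M=\{x: c_1(x)=\dots=c_m(x)=0\}$, and assume that $\nabla c_1(x),\dots,\nabla c_m(x)$ are linearly independent for every $x\in\mathcal M$. Let $T_x\mathcal M=\{v: \langle\nabla c_i(x),v\rangle=0,\ 1\le i\le m\}$, let $P(x)$ be the orthogonal projection onto $T_x\mathcal M$, and let $\operatorname{grad}f(x)=P(x)\nabla f(x)$ and $\operatorname{Hess}f(x)[v]=P(x)\,\partial_v(\operatorname{grad}f)(x)$, $v\in T_x\mathcal M$. Let $d(\cdot,\cdot)$ be the geodesic distance on $\mathcal M$. Let $\mathrm{Ret}$ be a retraction, i.e. a smooth map $T\mathcal M\to\mathcal M$, $(x,\eta)\mapsto\mathrm{Ret}_x(\eta)$, with $\mathrm{Ret}_x(0)=x$ and $\frac{d}{dt}\big|_{t=0}\mathrm{Ret}_x(t\eta)=\eta$ for all $\eta\in T_x\mathcal M$. Assume that $x^*\in\mathcal M$ is a strict index-$k$ saddle point in the following sense: $\operatorname{grad}f(x^*)=0$,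 and there are $\delta>0$ and $L>\mu>0$ such that for all $x\in\mathcal M$ with $d(x,x^*)<\delta$ the eigenvalues of $\operatorname{Hess}f(x)$, counted with multiplicity, satisfy $$-L\le\lambda_1\le\dots\le\lambda_k\le-\mu<0<\mu\le\lambda_{k+1}\le\dots\le\lambda_{d-m}\le L .$$ Let $\Pi(x)$ denote the orthogonal projection of $T_x\mathcal M$ onto the span of the eigenvectors of $\operatorname{Hess}f(x)$ with negative eigenvalues, and let $0\le\theta<\frac{\mu}{2L}$. Then there is a neighbourhood $U$ of $x^*$ in $\mathcal M$ such that for every step size $0<\Delta t\le 1/L$ and every sequence $(x_n)_{n\ge0}$ in $\mathcal M$ with $x_0\in U$ and $$x_{n+1}=\mathrm{Ret}_{x_n}\bigl(-\Delta t\,(I-2\hat P_n)\operatorname{grad}f(x_n)\bigr),$$ where the $\hat P_n:T_{x_n}\mathcal M\to T_{x_n}\mathcal M$ are linear operators with $\|\hat P_n-\Pi(x_n)\|\le\theta$ (operator norm) for all $n$, the iterates converge to $x^*$, and they do so linearly: $d(x_0,x^*)<\infty$ and $$d(x_{n+1},x^*)\le\Bigl(1-\Delta t\,L\Bigl(\frac{\mu}{2L}-\theta\Bigr)\Bigr)\,d(x_n,x^*)\qquad\text{for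 all } n\ge0 .$$ In particular, for $\Delta t=1/L$ the linear rate is $1-\frac{\mu}{2L}+\theta$, where $\frac{\mu}{2L}=\frac1{2\kappa}$ with $\kappa=L/\mu$. -/

import Mathlib

open Set Filter Topology
open scoped ContDiff ENNReal

namespace CSD

noncomputable section

/-- The ambient space `ℝ^d` with its Euclidean inner product. -/
abbrev E (d : ℕ) : Type := EuclideanSpace ℝ (Fin d)

/-- The feasible set `M = {x : c₁(x) = ⋯ = c_m(x) = 0}`. -/
def feasible {d m : ℕ} (c : Fin m → E d → ℝ) : Set (E d) :=
  {x | ∀ i, c i x = 0}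

/-- Linear independence constraint qualification: at every feasible point the gradients of the
constraints are linearly independent. -/
def LICQ {d m : ℕ} (c : Fin m → E d → ℝ) : Prop :=
  ∀ x ∈ feasible c, LinearIndependent ℝ (fun i => gradient (c i) x)

/-- The normal space `N_x M`, spanned by the gradients of the constraints. -/
def normalSpace {d m : ℕ} (c : Fin m → E d → ℝ) (x : E d) : Submodule ℝ (E d) :=
  Submodule.span ℝ (range fun i => gradient (c i) x)

/-- The tangent space `T_x M`, the orthogonal complement of the normal space. -/
abbrev tangentSpace {d m : ℕ} (c : Fin m → E d → ℝ) (x : E d) : Submodule ℝ (E d) :=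
  (normalSpace c x)ᗮ

/-- The Riemannian gradient `grad f(x) = P(x) ∇f(x)`, as a vector of `T_x M`; here `P(x)` is the
orthogonal projection onto `T_x M`. -/
def riemGrad {d m : ℕ} (c : Fin m → E d → ℝ) (f : E d → ℝ) (x : E d) : tangentSpace c x :=
  (tangentSpace c x).orthogonalProjectionOnto (gradient f x)

/-- The Riemannian Hessian `Hess f(x)[v] = P(x) (∂_v grad f(x))` on `T_x M`.
The formula for `grad f` makes sense (and is smooth, under LICQ) on an ambient
neighbourhood of `M`, so that the ambient directional derivative is meaningful. -/
def riemHess {d m : ℕ} (c : Fin m → E d → ℝ) (f : E d → ℝ) (x : E d) :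
    tangentSpace c x →L[ℝ] tangentSpace c x :=
  (tangentSpace c x).orthogonalProjectionOnto ∘L
    (fderiv ℝ (fun y => (riemGrad c f y : E d)) x) ∘L (tangentSpace c x).subtypeL

/-- The unstable subspace of a linear operator: the span of its eigenvectors with negative
eigenvalue. -/
def negSpace {V : Type*} [AddCommGroup V] [Module ℝ V] (H : Module.End ℝ V) : Submodule ℝ V :=
  ⨆ a : {a : ℝ // a < 0}, H.eigenspace (a : ℝ)

/-- The exact unstable projector `∑_{i ≤ k} vⁱ(x) vⁱ(x)ᵀ` on `T_x M`: the orthogonal projection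
onto the span of the eigenvectors of `Hess f(x)` with negative eigenvalue. -/
def unstableProj {d m : ℕ} (c : Fin m → E d → ℝ) (f : E d → ℝ) (x : E d) :
    tangentSpace c x →L[ℝ] tangentSpace c x :=
  (negSpace (riemHess c f x : tangentSpace c x →ₗ[ℝ] tangentSpace c x)).starProjection

/-- Length of a curve `γ : [0, 1] → ℝ^d`. -/
def curveLength {d : ℕ} (γ : ℝ → E d) : ℝ≥0∞ :=
  ∫⁻ t in Icc (0 : ℝ) 1, ‖derivWithin γ (Icc (0 : ℝ) 1) t‖ₑ

/-- Geodesic distance on a subset `M` of `ℝ^d`: the infimum of the lengths of the `C¹` curves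
in `M` that join the two points (`∞` if there is none). -/
def geoDist {d : ℕ} (M : Set (E d)) (x y : E d) : ℝ≥0∞ :=
  ⨅ γ ∈ {γ : ℝ → E d | ContDiffOn ℝ 1 γ (Icc 0 1) ∧ MapsTo γ (Icc 0 1) M ∧ γ 0 = x ∧ γ 1 = y},
    curveLength γ

/-- The tangent bundle `TM = {(x, η) : x ∈ M, η ∈ T_x M}`. -/
def tangentBundle {d m : ℕ} (c : Fin m → E d → ℝ) : Set (E d × E d) :=
  {p | p.1 ∈ feasible c ∧ p.2 ∈ tangentSpace c p.1}

/-- `Ret` is a retraction: a smooth map `TM → M`, `(x, η) ↦ Ret_x(η)`, with `Ret_x(0) = x` and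
`d/dt Ret_x(t η) = η` at `t = 0`. Only the values of `Ret` on `TM` matter. -/
structure IsRetraction {d m : ℕ} (c : Fin m → E d → ℝ) (Ret : E d → E d → E d) : Prop where
  mem : ∀ x ∈ feasible c, ∀ η ∈ tangentSpace c x, Ret x η ∈ feasible c
  smooth : ContDiffOn ℝ ∞ (fun p : E d × E d => Ret p.1 p.2) (tangentBundle c)
  map_zero : ∀ x ∈ feasible c, Ret x 0 = x
  deriv_zero : ∀ x ∈ feasible c, ∀ η ∈ tangentSpace c x,
    HasDerivAt (fun t : ℝ => Ret x (t • η)) η 0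

/-- `xs ∈ M` is a critical point, and on the geodesic ball of radius `δ` around it the
eigenvalues of `Hess f(x)`, counted with multiplicity, satisfy
`-L ≤ λ₁ ≤ ⋯ ≤ λ_k ≤ -μ < 0 < μ ≤ λ_{k+1} ≤ ⋯ ≤ λ_{d-m} ≤ L`:
all of them lie in `[-L, -μ] ∪ [μ, L]`, and the negative ones have total multiplicity `k`. -/
structure IsStrictSaddle {d m : ℕ} (c : Fin m → E d → ℝ) (f : E d → ℝ) (k : ℕ) (xs : E d)
    (δ μ L : ℝ) : Prop where
  mem : xs ∈ feasible c
  critical : riemGrad c f xs = 0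
  delta_pos : 0 < δ
  mu_pos : 0 < μ
  mu_lt : μ < L
  eigenvalue_mem : ∀ x ∈ feasible c, geoDist (feasible c) x xs < ENNReal.ofReal δ →
    ∀ a : ℝ, Module.End.HasEigenvalue
      (riemHess c f x : tangentSpace c x →ₗ[ℝ] tangentSpace c x) a →
      a ∈ Icc (-L) (-μ) ∪ Icc μ L
  finrank_neg : ∀ x ∈ feasible c, geoDist (feasible c) x xs < ENNReal.ofReal δ →
    Module.finrank ℝ
      (negSpace (riemHess c f x : tangentSpace c x →ₗ[ℝ] tangentSpace c x)) = k

/-- `x` is a sequence of iterates of the discrete constrained saddle dynamics with step size `dt`,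
in which the operator `Q n` on the tangent space at `x n` replaces the exact unstable projector:
`x_{n+1} = Ret_{x_n}(-dt (I - 2 Q_n) grad f(x_n))`, starting on `M`. -/
def IsInexactCSD {d m : ℕ} (c : Fin m → E d → ℝ) (f : E d → ℝ) (Ret : E d → E d → E d)
    (dt : ℝ) (x : ℕ → E d) (Q : ∀ n, tangentSpace c (x n) →L[ℝ] tangentSpace c (x n)) : Prop :=
  x 0 ∈ feasible c ∧
  ∀ n, x (n + 1) =
    Ret (x n) ((-dt) • (riemGrad c f (x n) - (2 : ℝ) • Q n (riemGrad c f (x n))) :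
      tangentSpace c (x n))

end

end CSD

/-!
The step that produces `x_{n+1}` from `x_n` is the value at `x_n` of a map of `M` into itself: with
`P(y)` the projection onto `T_y M` and `K = (I - 2 Q_n) P(x_n)` frozen, put
`Φ(y) = Ret_y(-s P(y) K grad f(y))` (`stepMap`). Then `Φ(x_n) = x_{n+1}`, and `Φ(xs) = xs` since
`grad f(xs) = 0`. If `Φ` shrinks the velocity of every `C¹` curve in `M` near `xs` by a factor `q`,
then it shrinks the lengths of the short curves from `x_n` to `xs`, hence the geodesic distance to
`xs` (`geoDist_map_le`); no geodesics or normal coordinates are needed.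

To first order at `xs`, the velocity `v` of a curve becomes `v - s (I - 2 Q_n) Hess f v`. The Hessian
is symmetric (`isSymmetric_riemHess`), so an eigenbasis and the spectral gap give the bound
`1 - s (μ - 2 θ L) = 1 - 2 s β`, where `β = L (μ / (2 L) - θ)` (`norm_sub_smul_le`). The claim asks
only for `1 - s β`, and the spare `s β` absorbs the errors, provided that these are `s` times a
small constant, uniformly in `s`, `x_n` and `Q_n`. This holds because all errors vanish at `s = 0`:
the derivative of the retraction fixes vectors along the zero section and is Lipschitz along the
fibres of the tangent bundle (`IsRetraction.exists_hasFDerivWithinAt`, `norm_apply_prod_sub_le`),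
while the remaining errors come from the continuity at `xs` of `P`, `grad f` and its derivative
(`norm_direction_deriv_le`). The spectral bound is used at `x_n` itself, so that no continuity of the
unstable projector is required.

Points of `M` near `xs` have small geodesic distance to `xs` by the inverse function theorem
(`eventually_geoDist_lt`), so that the geodesic balls around `xs` are neighbourhoods of `xs` in `M`.
-/

namespace CSD

/-! ### Smoothness of the tangential projection and of the Riemannian gradient -/

theorem contDiff_gradient {d : ℕ} {f : E d → ℝ} (hf : ContDiff ℝ ∞ f) :
    ContDiff ℝ ∞ (gradient f) := by
  have h : gradient f = fun x => ∑ i, fderiv ℝ f x ((EuclideanSpace.basisFun (Fin d) ℝ) i) •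
      (EuclideanSpace.basisFun (Fin d) ℝ) i := by
    funext x
    rw [← (EuclideanSpace.basisFun (Fin d) ℝ).sum_repr' (gradient f x)]
    refine Finset.sum_congr rfl fun i _ => ?_
    rw [real_inner_comm, inner_gradient_left]
  rw [h]
  refine ContDiff.sum fun i _ => ContDiff.fun_smul ?_ contDiff_const
  exact (hf.fderiv_right (m := ∞) (by norm_cast)).clm_apply contDiff_const

theorem inner_fderiv_gradient {d : ℕ} {f : E d → ℝ} (hf : ContDiff ℝ ∞ f) (x v w : E d) :
    inner ℝ (fderiv ℝ (gradient f) x v) w = fderiv ℝ (fderiv ℝ f) x v w := by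
  have h1 : HasFDerivAt (fun y => inner ℝ (gradient f y) w) _ x :=
    (((contDiff_gradient hf).differentiable (by simp)) x).hasFDerivAt.inner ℝ
      (hasFDerivAt_const w x)
  have h2 : HasFDerivAt (fun y => fderiv ℝ f y w) _ x :=
    ((((hf.fderiv_right (m := ∞) (by norm_cast)).differentiable (by simp)) x).hasFDerivAt).clm_apply
      (hasFDerivAt_const w x)
  have h3 : (fun y => inner ℝ (gradient f y) w) = fun y => fderiv ℝ f y w := by
    funext y; rw [inner_gradient_left]
  rw [h3] at h1
  have := congrArg (fun T => T v) (h1.unique h2)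
  simpa using this

theorem inner_fderiv_gradient_comm {d : ℕ} {f : E d → ℝ} (hf : ContDiff ℝ ∞ f) (x v w : E d) :
    inner ℝ (fderiv ℝ (gradient f) x v) w = inner ℝ v (fderiv ℝ (gradient f) x w) := by
  rw [inner_fderiv_gradient hf, real_inner_comm, inner_fderiv_gradient hf]
  exact ((hf.of_le ENat.LEInfty.out : ContDiff ℝ 2 f).contDiffAt.isSymmSndFDerivAt (by simp)) v w

/-- The differential of the constraint map `(c₁, …, c_m)`. -/
noncomputable def constraintDeriv {d m : ℕ} (c : Fin m → E d → ℝ) (x : E d) :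
    E d →L[ℝ] (Fin m → ℝ) :=
  ContinuousLinearMap.pi fun i => fderiv ℝ (c i) x

/-- The adjoint `a ↦ ∑ aᵢ ∇cᵢ(x)` of the differential of the constraint map. -/
noncomputable def gradientComb {d m : ℕ} (c : Fin m → E d → ℝ) (x : E d) :
    (Fin m → ℝ) →L[ℝ] E d :=
  ∑ i, (ContinuousLinearMap.proj (R := ℝ) (φ := fun _ : Fin m => ℝ) i).smulRight
    (gradient (c i) x)

/-- The Gram matrix of the constraint gradients, as an operator on `ℝ^m`. -/
noncomputable def gramOp {d m : ℕ} (c : Fin m → E d → ℝ) (x : E d) :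
    (Fin m → ℝ) →L[ℝ] (Fin m → ℝ) :=
  constraintDeriv c x ∘L gradientComb c x

theorem gradientComb_apply {d m : ℕ} (c : Fin m → E d → ℝ) (x : E d) (a : Fin m → ℝ) :
    gradientComb c x a = ∑ i, a i • gradient (c i) x := by
  simp [gradientComb]

theorem mem_tangentSpace_iff {d m : ℕ} (c : Fin m → E d → ℝ) (x v : E d) :
    v ∈ tangentSpace c x ↔ constraintDeriv c x v = 0 := by
  have : v ∈ tangentSpace c x ↔ ∀ i, inner ℝ (gradient (c i) x) v = 0 := by
    rw [tangentSpace, normalSpace, Submodule.mem_orthogonal]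
    constructor
    · intro h i
      exact h _ (Submodule.subset_span ⟨i, rfl⟩)
    · intro h u hu
      induction hu using Submodule.span_induction with
      | mem u hu => obtain ⟨i, rfl⟩ := hu; exact h i
      | zero => simp
      | add u w _ _ hu hw => rw [inner_add_left, hu, hw, add_zero]
      | smul a u _ hu => rw [inner_smul_left, hu, mul_zero]
  rw [this, funext_iff]
  simp [constraintDeriv, inner_gradient_left]

theorem gradientComb_mem_normalSpace {d m : ℕ} (c : Fin m → E d → ℝ) (x : E d) (a : Fin m → ℝ) :
    gradientComb c x a ∈ normalSpace c x := by
  rw [gradientComb_apply]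
  exact Submodule.sum_mem _ fun i _ => Submodule.smul_mem _ _ (Submodule.subset_span ⟨i, rfl⟩)

theorem eq_zero_of_constraintDeriv_gradientComb {d m : ℕ} {c : Fin m → E d → ℝ} {x : E d}
    (h : LinearIndependent ℝ fun i => gradient (c i) x) {a : Fin m → ℝ}
    (ha : constraintDeriv c x (gradientComb c x a) = 0) : a = 0 := by
  have h0 : gradientComb c x a = 0 :=
    inner_self_eq_zero.1 (((mem_tangentSpace_iff c x _).2 ha) _
      (gradientComb_mem_normalSpace c x a))
  rw [gradientComb_apply] at h0
  exact funext (Fintype.linearIndependent_iff.1 h a h0)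

theorem isUnit_gramOp {d m : ℕ} {c : Fin m → E d → ℝ} {x : E d}
    (h : LinearIndependent ℝ fun i => gradient (c i) x) : IsUnit (gramOp c x) := by
  rw [ContinuousLinearMap.isUnit_iff_bijective]
  have hinj : Function.Injective (gramOp c x) := by
    rw [injective_iff_map_eq_zero]
    exact fun a ha => eq_zero_of_constraintDeriv_gradientComb h ha
  exact ⟨hinj, LinearMap.injective_iff_surjective (f := (gramOp c x).toLinearMap).1 hinj⟩

theorem contDiff_constraintDeriv {d m : ℕ} {c : Fin m → E d → ℝ} (hc : ∀ i, ContDiff ℝ ∞ (c i)) :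
    ContDiff ℝ ∞ (constraintDeriv c) := by
  have : constraintDeriv c = fun x => ∑ i, (ContinuousLinearMap.single ℝ (fun _ : Fin m => ℝ) i) ∘L
      fderiv ℝ (c i) x := by
    funext x
    ext v i
    simp [constraintDeriv, Pi.single_apply]
  rw [this]
  exact ContDiff.sum fun i _ => contDiff_const.clm_comp
    ((hc i).fderiv_right (m := ∞) (by norm_cast))

theorem contDiff_gradientComb {d m : ℕ} {c : Fin m → E d → ℝ} (hc : ∀ i, ContDiff ℝ ∞ (c i)) :
    ContDiff ℝ ∞ (gradientComb c) :=
  ContDiff.sum fun i _ => contDiff_const.smulRight (contDiff_gradient (hc i))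

theorem contDiff_gramOp {d m : ℕ} {c : Fin m → E d → ℝ} (hc : ∀ i, ContDiff ℝ ∞ (c i)) :
    ContDiff ℝ ∞ (gramOp c) :=
  (contDiff_constraintDeriv hc).clm_comp (contDiff_gradientComb hc)

/-- The tangential part of a vector is what remains after subtracting the combination of the
constraint gradients whose coefficients solve the normal equations. -/
theorem starProjection_tangentSpace {d m : ℕ} {c : Fin m → E d → ℝ} {x : E d}
    (h : IsUnit (gramOp c x)) (v : E d) :
    (tangentSpace c x).starProjection v =
      v - gradientComb c x (Ring.inverse (gramOp c x) (constraintDeriv c x v)) := by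
  refine (Submodule.eq_starProjection_of_mem_orthogonal ?_ ?_)
  · rw [mem_tangentSpace_iff, map_sub]
    have := congrArg (fun T => T (constraintDeriv c x v)) (Ring.mul_inverse_cancel _ h)
    simp only [mul_apply_eq_comp, one_apply_eq_self] at this
    change _ - gramOp c x _ = 0
    rw [this, sub_self]
  · rw [sub_sub_cancel]
    exact Submodule.le_orthogonal_orthogonal _ (gradientComb_mem_normalSpace c x _)

theorem eventually_isUnit_gramOp {d m : ℕ} {c : Fin m → E d → ℝ} (hc : ∀ i, ContDiff ℝ ∞ (c i))
    {x : E d} (h : LinearIndependent ℝ fun i => gradient (c i) x) :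
    ∀ᶠ y in 𝓝 x, IsUnit (gramOp c y) :=
  (contDiff_gramOp hc).continuous.continuousAt.eventually
    (Units.isOpen.mem_nhds (isUnit_gramOp h))

theorem contDiffAt_inverse_gramOp {d m : ℕ} {c : Fin m → E d → ℝ} (hc : ∀ i, ContDiff ℝ ∞ (c i))
    {x : E d} (h : LinearIndependent ℝ fun i => gradient (c i) x) :
    ContDiffAt ℝ ∞ (fun y => Ring.inverse (gramOp c y)) x := by
  obtain ⟨u, hu⟩ := isUnit_gramOp h
  have := contDiffAt_ringInverse ℝ (n := ∞) u
  rw [hu] at this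
  exact this.comp x (contDiff_gramOp hc).contDiffAt

theorem contDiffAt_starProjection_tangentSpace {d m : ℕ} {c : Fin m → E d → ℝ}
    (hc : ∀ i, ContDiff ℝ ∞ (c i)) {x : E d}
    (h : LinearIndependent ℝ fun i => gradient (c i) x) :
    ContDiffAt ℝ ∞ (fun y => (tangentSpace c y).starProjection) x := by
  have h1 : ContDiffAt ℝ ∞ (fun y => ContinuousLinearMap.id ℝ (E d) -
      gradientComb c y ∘L Ring.inverse (gramOp c y) ∘L constraintDeriv c y) x :=
    contDiffAt_const.sub ((contDiff_gradientComb hc).contDiffAt.clm_comp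
      ((contDiffAt_inverse_gramOp hc h).clm_comp (contDiff_constraintDeriv hc).contDiffAt))
  refine h1.congr_of_eventuallyEq ?_
  filter_upwards [eventually_isUnit_gramOp hc h] with y hy
  ext1 v
  rw [starProjection_tangentSpace hy]
  rfl

theorem coe_riemGrad {d m : ℕ} (c : Fin m → E d → ℝ) (f : E d → ℝ) (x : E d) :
    (riemGrad c f x : E d) = (tangentSpace c x).starProjection (gradient f x) := rfl

theorem contDiffAt_riemGrad {d m : ℕ} {c : Fin m → E d → ℝ}
    (hc : ∀ i, ContDiff ℝ ∞ (c i)) {f : E d → ℝ} (hf : ContDiff ℝ ∞ f) {x : E d}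
    (h : LinearIndependent ℝ fun i => gradient (c i) x) :
    ContDiffAt ℝ ∞ (fun y => (riemGrad c f y : E d)) x :=
  (contDiffAt_starProjection_tangentSpace hc h).clm_apply (contDiff_gradient hf).contDiffAt

theorem coe_riemHess {d m : ℕ} (c : Fin m → E d → ℝ) (f : E d → ℝ) (x : E d)
    (v : tangentSpace c x) : (riemHess c f x v : E d) = (tangentSpace c x).starProjection
      (fderiv ℝ (fun y => (riemGrad c f y : E d)) x v) := rfl

/-! ### The Riemannian Hessian is symmetric -/

/-- With Lagrange multipliers `a`, the derivative of `grad f = ∇f - ∑ aᵢ ∇cᵢ` differs from the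
symmetric operator `∇²f - ∑ aᵢ ∇²cᵢ` by a map into the normal space. -/
theorem inner_fderiv_riemGrad {d m : ℕ} {c : Fin m → E d → ℝ}
    (hc : ∀ i, ContDiff ℝ ∞ (c i)) {f : E d → ℝ} (hf : ContDiff ℝ ∞ f) {x : E d}
    (h : LinearIndependent ℝ fun i => gradient (c i) x) :
    ∃ a : Fin m → ℝ, ∀ v, ∀ w ∈ tangentSpace c x,
      inner ℝ (fderiv ℝ (fun y => (riemGrad c f y : E d)) x v) w =
        inner ℝ (fderiv ℝ (gradient f) x v) w -
          ∑ i, a i * inner ℝ (fderiv ℝ (gradient (c i)) x v) w := by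
  set l : E d → Fin m → ℝ := fun y =>
    Ring.inverse (gramOp c y) (constraintDeriv c y (gradient f y)) with hl
  have hl1 : ContDiffAt ℝ ∞ l x := (contDiffAt_inverse_gramOp hc h).clm_apply
    ((contDiff_constraintDeriv hc).contDiffAt.clm_apply (contDiff_gradient hf).contDiffAt)
  have hl2 : ∀ i, DifferentiableAt ℝ (fun y => l y i) x := fun i =>
    differentiableAt_pi.1 (hl1.differentiableAt (by simp)) i
  refine ⟨l x, fun v w hw => ?_⟩
  have heq : (fun y => (riemGrad c f y : E d)) =ᶠ[𝓝 x]
      fun y => gradient f y - ∑ i, l y i • gradient (c i) y := by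
    filter_upwards [eventually_isUnit_gramOp hc h] with y hy
    rw [coe_riemGrad, starProjection_tangentSpace hy, gradientComb_apply]
  have hd : HasFDerivAt (fun y => gradient f y - ∑ i, l y i • gradient (c i) y) _ x :=
    (((contDiff_gradient hf).differentiable (by simp)) x).hasFDerivAt.sub
      (HasFDerivAt.fun_sum fun i _ => (hl2 i).hasFDerivAt.smul
        (((contDiff_gradient (hc i)).differentiable (by simp)) x).hasFDerivAt)
  rw [heq.fderiv_eq, hd.fderiv]
  have hn : ∀ i, inner ℝ (gradient (c i) x) w = 0 := fun i =>
    hw _ (Submodule.subset_span ⟨i, rfl⟩)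
  simp [inner_sub_left, sum_inner, inner_add_left, inner_smul_left, hn]

theorem isSymmetric_riemHess {d m : ℕ} {c : Fin m → E d → ℝ}
    (hc : ∀ i, ContDiff ℝ ∞ (c i)) {f : E d → ℝ} (hf : ContDiff ℝ ∞ f) {x : E d}
    (h : LinearIndependent ℝ fun i => gradient (c i) x) :
    (riemHess c f x : tangentSpace c x →ₗ[ℝ] tangentSpace c x).IsSymmetric := by
  obtain ⟨a, ha⟩ := inner_fderiv_riemGrad hc hf h
  have key : ∀ v w : tangentSpace c x, inner ℝ (riemHess c f x v) w =
      inner ℝ (fderiv ℝ (gradient f) x v) (w : E d) -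
          ∑ i, a i * inner ℝ (fderiv ℝ (gradient (c i)) x v) (w : E d) := by
    intro v w
    rw [← ha v w w.2, Submodule.coe_inner, coe_riemHess,
      Submodule.inner_starProjection_left_eq_right,
      Submodule.starProjection_eq_self_iff.2 w.2]
  intro v w
  change inner ℝ (riemHess c f x v) w = inner ℝ v (riemHess c f x w)
  rw [key, real_inner_comm (riemHess c f x w) v, key, inner_fderiv_gradient_comm hf,
    real_inner_comm]
  congr 1
  refine Finset.sum_congr rfl fun i _ => ?_
  rw [inner_fderiv_gradient_comm (hc i), real_inner_comm]

/-! ### The spectral estimate on the tangent space -/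

section Spectral

variable {V : Type*} [NormedAddCommGroup V] [InnerProductSpace ℝ V]

theorem norm_le_mul_of_abs_inner_le {n : ℕ} (b : OrthonormalBasis (Fin n) ℝ V) {u v : V} {K : ℝ}
    (hK : 0 ≤ K) (h : ∀ i, |inner ℝ (b i) u| ≤ K * |inner ℝ (b i) v|) : ‖u‖ ≤ K * ‖v‖ := by
  refine le_of_sq_le_sq ?_ (by positivity)
  rw [mul_pow, ← b.sum_sq_norm_inner_right u, ← b.sum_sq_norm_inner_right v, Finset.mul_sum]
  refine Finset.sum_le_sum fun i _ => ?_
  rw [← mul_pow]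
  exact pow_le_pow_left₀ (abs_nonneg _) (h i) 2

variable [FiniteDimensional ℝ V]

theorem starProjection_negSpace_of_neg {H : V →ₗ[ℝ] V} {a : ℝ} (ha : a < 0) {e : V}
    (he : H e = a • e) : (negSpace H).starProjection e = e := by
  rw [Submodule.starProjection_eq_self_iff]
  exact (le_iSup (fun a : {a : ℝ // a < 0} => Module.End.eigenspace H (a : ℝ)) ⟨a, ha⟩)
    (Module.End.mem_eigenspace_iff.2 he)

theorem starProjection_negSpace_of_nonneg {H : V →ₗ[ℝ] V} (hH : H.IsSymmetric) {a : ℝ}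
    (ha : 0 ≤ a) {e : V} (he : H e = a • e) : (negSpace H).starProjection e = 0 := by
  rw [Submodule.starProjection_apply_eq_zero_iff, negSpace, ← Submodule.iInf_orthogonal,
    Submodule.mem_iInf]
  intro t
  rw [Submodule.mem_orthogonal]
  intro u hu
  rw [Module.End.mem_eigenspace_iff] at hu
  have h := hH u e
  rw [hu, he, real_inner_smul_left, real_inner_smul_right] at h
  have h2 : ((t : ℝ) - a) * inner ℝ u e = 0 := by linarith
  exact (mul_eq_zero.1 h2).resolve_left (by have := t.2; linarith)

/-- If the spectrum of the symmetric operator `H` lies in `[-L, -μ] ∪ [μ, L]` and `Q` is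
`θ`-close to the projection onto its unstable subspace, then `(I - 2 Q) H` is within `2 θ L` of
`|H|`, whose spectrum lies in `[μ, L]`; hence the explicit Euler step contracts. -/
theorem norm_sub_smul_le {H : V →L[ℝ] V} (hH : (H : V →ₗ[ℝ] V).IsSymmetric) {μ L θ s : ℝ}
    (hμ : 0 < μ) (hμL : μ < L)
    (hspec : ∀ a : ℝ, Module.End.HasEigenvalue (H : V →ₗ[ℝ] V) a → a ∈ Icc (-L) (-μ) ∪ Icc μ L)
    {Q : V →L[ℝ] V} (hQ : ‖Q - (negSpace (H : V →ₗ[ℝ] V)).starProjection‖ ≤ θ)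
    (hs : 0 < s) (hsL : s * L ≤ 1) (v : V) :
    ‖v - s • (H v - (2 : ℝ) • Q (H v))‖ ≤ (1 - s * (μ - 2 * θ * L)) * ‖v‖ := by
  set N := (negSpace (H : V →ₗ[ℝ] V)).starProjection with hN
  set b := hH.eigenvectorBasis rfl with hb
  set l := hH.eigenvalues rfl with hl
  have hbe : ∀ i, H (b i) = l i • b i := fun i => hH.apply_eigenvectorBasis rfl i
  have hli : ∀ i, l i ∈ Icc (-L) (-μ) ∪ Icc μ L := fun i =>
    hspec _ (hH.hasEigenvalue_eigenvalues rfl i)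
  have hHv : ∀ i w, inner ℝ (b i) (H w) = l i * inner ℝ (b i) w := fun i w => by
    rw [← real_inner_smul_left, ← hbe i]
    exact (hH (b i) w).symm
  have hLn : ‖H v‖ ≤ L * ‖v‖ := by
    refine norm_le_mul_of_abs_inner_le b (by linarith) fun i => ?_
    rw [hHv, abs_mul]
    refine mul_le_mul_of_nonneg_right ?_ (abs_nonneg _)
    rw [abs_le]
    rcases hli i with h | h <;> constructor <;> linarith [h.1, h.2]
  have hmain : ‖v - s • (H v - (2 : ℝ) • N (H v))‖ ≤ (1 - s * μ) * ‖v‖ := by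
    refine norm_le_mul_of_abs_inner_le b (by nlinarith) fun i => ?_
    have hNi : ∀ w, inner ℝ (b i) (N w) = inner ℝ (N (b i)) w := fun w =>
      (Submodule.inner_starProjection_left_eq_right _ _ _).symm
    have hval : inner ℝ (b i) (v - s • (H v - (2 : ℝ) • N (H v))) =
        (1 - s * |l i|) * inner ℝ (b i) v := by
      rw [inner_sub_right, real_inner_smul_right, inner_sub_right, real_inner_smul_right, hNi]
      rcases hli i with h | h
      · have h0 : l i < 0 := by linarith [h.2]
        rw [hN, starProjection_negSpace_of_neg h0 (hbe i), hHv, abs_of_neg h0]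
        ring
      · have h0 : 0 ≤ l i := by linarith [h.1]
        rw [hN, starProjection_negSpace_of_nonneg hH h0 (hbe i), inner_zero_left, hHv,
          abs_of_nonneg h0]
        ring
    rw [hval, abs_mul]
    refine mul_le_mul_of_nonneg_right ?_ (abs_nonneg _)
    have h1 : μ ≤ |l i| ∧ |l i| ≤ L := by
      rcases hli i with h | h
      · rw [abs_of_neg (by linarith [h.2])]; constructor <;> linarith [h.1, h.2]
      · rw [abs_of_nonneg (by linarith [h.1])]; exact h
    rw [abs_of_nonneg (by nlinarith)]
    nlinarith
  have hdec : v - s • (H v - (2 : ℝ) • Q (H v)) =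
      (v - s • (H v - (2 : ℝ) • N (H v))) + (2 * s) • (Q - N) (H v) := by
    simp only [sub_apply]
    module
  calc ‖v - s • (H v - (2 : ℝ) • Q (H v))‖
      ≤ (1 - s * μ) * ‖v‖ + (2 * s) * (θ * (L * ‖v‖)) := by
        rw [hdec]
        refine (norm_add_le _ _).trans (add_le_add hmain ?_)
        rw [norm_smul, Real.norm_of_nonneg (by positivity)]
        gcongr
        exact ((Q - N).le_opNorm _).trans (mul_le_mul hQ hLn (norm_nonneg _)
          ((norm_nonneg _).trans hQ))
    _ = (1 - s * (μ - 2 * θ * L)) * ‖v‖ := by ring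

end Spectral

/-! ### First-order behaviour of the retraction -/

/-- Near `(xs, 0)` the retraction has a derivative along the tangent bundle which is continuous
at `(xs, 0)`, Lipschitz along the fibres, and the identity on vertical vectors at `(xs, 0)`. -/
theorem IsRetraction.exists_hasFDerivWithinAt {d m : ℕ} {c : Fin m → E d → ℝ}
    {Ret : E d → E d → E d} (hRet : IsRetraction c Ret) {xs : E d} (hxs : xs ∈ feasible c) :
    ∃ (F' : E d × E d → (E d × E d →L[ℝ] E d)) (C : ℝ), 0 ≤ C ∧
      (∀ ζ ∈ tangentSpace c xs, F' (xs, 0) (0, ζ) = ζ) ∧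
      ∀ ε > 0, ∃ r > 0, ∀ y ∈ feasible c, ∀ η ∈ tangentSpace c y, ‖y - xs‖ < r → ‖η‖ < r →
        HasFDerivWithinAt (fun p : E d × E d => Ret p.1 p.2) (F' (y, η)) (tangentBundle c) (y, η) ∧
        ‖F' (y, η) - F' (xs, 0)‖ ≤ ε ∧ ‖F' (y, η) - F' (y, 0)‖ ≤ C * ‖η‖ := by
  set S := tangentBundle c with hS
  have h0 : (xs, (0 : E d)) ∈ S := ⟨hxs, Submodule.zero_mem _⟩
  have h2 : ContDiffWithinAt ℝ (1 + 1) (fun p : E d × E d => Ret p.1 p.2) S (xs, 0) :=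
    (hRet.smooth _ h0).of_le (by norm_num; exact ENat.LEInfty.out)
  obtain ⟨u, hu, -, -, F', hF', hF'1⟩ :=
    (contDiffWithinAt_succ_iff_hasFDerivWithinAt' (by simp)).1 h2
  have h1 : ContDiffWithinAt ℝ (0 + 1) F' S (xs, 0) := by simpa using hF'1
  obtain ⟨u2, hu2, -, -, F2, hF2, hF21⟩ :=
    (contDiffWithinAt_succ_iff_hasFDerivWithinAt' (by simp)).1 h1
  rw [insert_eq_of_mem h0] at hu hu2
  have hb : ∀ᶠ p in 𝓝[S] (xs, (0 : E d)), ‖F2 p‖ < ‖F2 (xs, 0)‖ + 1 :=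
    hF21.continuousWithinAt.norm.eventually (gt_mem_nhds (by linarith))
  refine ⟨F', ‖F2 (xs, 0)‖ + 1, by positivity, ?_, ?_⟩
  · intro ζ hζ
    have hd := (hF' _ (mem_of_mem_nhdsWithin h0 hu))
    have hcurve : HasDerivAt (fun t : ℝ => (xs, t • ζ)) ((0 : E d), ζ) 0 := by
      have := (hasDerivAt_id (0 : ℝ)).smul_const ζ
      simpa using (hasDerivAt_const (0 : ℝ) xs).prodMk this
    have hd' : HasFDerivWithinAt (fun p : E d × E d => Ret p.1 p.2) (F' (xs, 0)) S
        ((fun t : ℝ => (xs, t • ζ)) 0) := by simpa using hd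
    have h3 := hd'.comp_hasDerivAt (0 : ℝ) hcurve
      (Eventually.of_forall fun t => show (xs, t • ζ) ∈ S from ⟨hxs, Submodule.smul_mem _ _ hζ⟩)
    exact h3.unique (hRet.deriv_zero xs hxs ζ hζ)
  · intro ε hε
    have hc : ∀ᶠ p in 𝓝[S] (xs, (0 : E d)), ‖F' p - F' (xs, 0)‖ < ε := by
      have := hF'1.continuousWithinAt.eventually (Metric.ball_mem_nhds _ hε)
      filter_upwards [this] with p hp
      simpa [dist_eq_norm] using hp
    have hall := (eventually_mem_set.2 hu).and ((eventually_mem_set.2 hu2).and (hb.and hc))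
    obtain ⟨r, hr, hball⟩ := Metric.mem_nhdsWithin_iff.1 hall
    have hmem : ∀ y ∈ feasible c, ∀ η ∈ tangentSpace c y, ‖y - xs‖ < r → ‖η‖ < r →
        (y, η) ∈ Metric.ball (xs, (0 : E d)) r ∩ S := by
      intro y hy η hη h1 h2
      refine ⟨?_, hy, hη⟩
      rw [Metric.mem_ball, Prod.dist_eq, dist_eq_norm, dist_eq_norm]
      simpa using ⟨h1, h2⟩
    refine ⟨r, hr, fun y hy η hη hyr hηr => ?_⟩
    have h4 := hball (hmem y hy η hη hyr hηr)
    refine ⟨hF' _ h4.1, h4.2.2.2.le, ?_⟩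
    -- mean value inequality along the fibre segment `t ↦ (y, t η)`
    have hseg : ∀ t ∈ Icc (0 : ℝ) 1, HasDerivWithinAt (fun t : ℝ => F' (y, t • η))
        (F2 (y, t • η) (0, η)) (Icc 0 1) t ∧ ‖F2 (y, t • η) (0, η)‖ ≤ (‖F2 (xs, 0)‖ + 1) * ‖η‖ := by
      intro t ht
      have hle : ‖t • η‖ ≤ ‖η‖ := by
        rw [norm_smul, Real.norm_of_nonneg ht.1]
        exact mul_le_of_le_one_left (norm_nonneg _) ht.2
      have h5 := hball (hmem y hy (t • η) (Submodule.smul_mem _ _ hη) hyr (hle.trans_lt hηr))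
      constructor
      · have hcurve : HasDerivWithinAt (fun t : ℝ => (y, t • η)) ((0 : E d), η) (Icc 0 1) t := by
          have := (hasDerivAt_id t).smul_const η
          simpa using ((hasDerivAt_const t y).prodMk this).hasDerivWithinAt
        exact (hF2 _ h5.2.1).comp_hasDerivWithinAt t hcurve
          (fun t' _ => show (y, t' • η) ∈ S from ⟨hy, Submodule.smul_mem _ _ hη⟩)
      · refine ((F2 (y, t • η)).le_opNorm _).trans ?_
        have : ‖((0 : E d), η)‖ = ‖η‖ := by simp [Prod.norm_def]
        rw [this]
        exact mul_le_mul_of_nonneg_right h5.2.2.1.le (norm_nonneg _)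
    have := norm_image_sub_le_of_norm_deriv_le_segment_01' (fun t ht => (hseg t ht).1)
      (fun t ht => (hseg t (Ico_subset_Icc_self ht)).2)
    simpa using this

/-! ### Contraction of velocities -/

section Velocity

variable {X : Type*} [NormedAddCommGroup X] [InnerProductSpace ℝ X]

/-- `A`, `A₀`, `B` play the roles of the derivative of the retraction at `(y, s η)`, `(y, 0)` and
`(xs, 0)`. The error is proportional to `s`. -/
theorem norm_apply_prod_sub_le {A A₀ B : X × X →L[ℝ] X} {v z ζ : X} {s e ε C : ℝ} (hs : 0 ≤ s)
    (hA₀ : A₀ (v, 0) = v) (hB : B (0, ζ) = ζ) (hA : ‖A - A₀‖ ≤ C * (s * e)) (hAB : ‖A - B‖ ≤ ε) :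
    ‖A (v, s • z) - (v + s • ζ)‖ ≤ s * (C * e * ‖v‖ + ε * ‖z‖ + ‖B‖ * ‖z - ζ‖) := by
  have hdec : A (v, s • z) - (v + s • ζ) =
      (A - A₀) (v, 0) + s • ((A - B) (0, z) + B (0, z - ζ)) := by
    have h1 : (v, s • z) = (v, (0 : X)) + s • ((0 : X), z) := by simp
    have h2 : ((0 : X), z - ζ) = (0, z) - (0, ζ) := by simp
    rw [h1, h2, map_add, map_smul, map_sub, hB, sub_apply, sub_apply, hA₀]
    module
  have hn1 : ‖(v, (0 : X))‖ = ‖v‖ := by simp [Prod.norm_def]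
  have hn2 : ∀ w : X, ‖((0 : X), w)‖ = ‖w‖ := fun w => by simp [Prod.norm_def]
  have e1 : ‖(A - A₀) (v, 0)‖ ≤ C * (s * e) * ‖v‖ := by
    refine ((A - A₀).le_opNorm _).trans ?_
    rw [hn1]; gcongr
  have e2 : ‖(A - B) (0, z)‖ ≤ ε * ‖z‖ := by
    refine ((A - B).le_opNorm _).trans ?_
    rw [hn2]; gcongr
  have e3 : ‖B (0, z - ζ)‖ ≤ ‖B‖ * ‖z - ζ‖ := by
    refine (B.le_opNorm _).trans ?_
    rw [hn2]
  rw [hdec]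
  calc _ ≤ ‖(A - A₀) (v, 0)‖ + s * (‖(A - B) (0, z)‖ + ‖B (0, z - ζ)‖) := by
        refine (norm_add_le _ _).trans ?_
        rw [norm_smul, Real.norm_of_nonneg hs]
        gcongr
        exact norm_add_le _ _
    _ ≤ C * (s * e) * ‖v‖ + s * (ε * ‖z‖ + ‖B‖ * ‖z - ζ‖) := by gcongr
    _ = _ := by ring

/-- A contraction estimate on a subspace extends to vectors near the subspace; by Pythagoras the
loss is only proportional to the gain `a`. -/
theorem norm_sub_apply_starProjection_le {U : Submodule ℝ X} [U.HasOrthogonalProjection] {N : X → X}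
    {a : ℝ} (ha : 0 ≤ a) (ha1 : a ≤ 1) (hNU : ∀ u ∈ U, N u ∈ U)
    (hN : ∀ u ∈ U, ‖u - N u‖ ≤ (1 - a) * ‖u‖) (v : X) :
    ‖v - N (U.starProjection v)‖ ≤ (1 - a) * ‖v‖ + a * ‖v - U.starProjection v‖ := by
  set u := U.starProjection v with hu
  have huU : u ∈ U := Submodule.starProjection_apply_mem _ _
  have hperp : ∀ w ∈ U, inner ℝ w (v - u) = 0 := fun w hw =>
    Submodule.sub_starProjection_mem_orthogonal (K := U) v w hw
  have hdec : v - N u = ((u - N u) + (1 - a) • (v - u)) + a • (v - u) := by module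
  have h1 : ‖(u - N u) + (1 - a) • (v - u)‖ ≤ (1 - a) * ‖v‖ := by
    refine le_of_sq_le_sq ?_ (mul_nonneg (by linarith) (norm_nonneg _))
    have e1 := norm_add_sq_eq_norm_sq_add_norm_sq_of_inner_eq_zero (u - N u) ((1 - a) • (v - u))
      (by rw [real_inner_smul_right, hperp _ (U.sub_mem huU (hNU u huU)), mul_zero])
    have e2 := norm_add_sq_eq_norm_sq_add_norm_sq_of_inner_eq_zero u (v - u) (hperp u huU)
    rw [add_sub_cancel] at e2
    rw [norm_smul, Real.norm_of_nonneg (by linarith : 0 ≤ 1 - a)] at e1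
    have e3 : ‖u - N u‖ ^ 2 ≤ ((1 - a) * ‖u‖) ^ 2 := pow_le_pow_left₀ (norm_nonneg _) (hN u huU) 2
    rw [mul_pow, sq ‖v‖, e2, sq ‖_ + _‖, e1]
    nlinarith
  rw [hdec]
  refine (norm_add_le _ _).trans (add_le_add h1 ?_)
  rw [norm_smul, Real.norm_of_nonneg ha]

/-- The velocity `z` of the search direction at `y`, its value `ζ` frozen at the saddle, and the
frozen operator `K ∘ Gₓ ∘ Pₓ` at the current iterate `x` agree up to `O(ε)`. -/
theorem norm_direction_deriv_le {P₀ Px Py G₀ Gx Gy K D : X →L[ℝ] X} {g v z ζ : X} {ε κ p : ℝ}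
    (hε1 : ε ≤ 1) (hPy : ‖Py‖ ≤ 1)
    (hPx₀ : ‖Px - P₀‖ ≤ ε) (hPy₀ : ‖Py - P₀‖ ≤ ε) (hGx : ‖Gx - G₀‖ ≤ ε) (hGy : ‖Gy - G₀‖ ≤ ε)
    (hK : ‖K‖ ≤ κ) (hD : ‖D‖ ≤ p * ‖v‖) (hg : ‖g‖ ≤ ε) (hv : Py v = v)
    (hPK : ∀ w, Px (K w) = K w)
    (hz : z = -(Py (K (Gy v)) + D (K g))) (hζ : ζ = -P₀ (K (G₀ v))) (hp : 0 ≤ p) :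
    ‖z - ζ‖ ≤ ε * (κ * (p + ‖G₀‖ + 1)) * ‖v‖ ∧ ‖z‖ ≤ κ * (p + ‖G₀‖ + 1) * ‖v‖ ∧
      ‖v - Px v‖ ≤ 2 * ε * ‖v‖ ∧ ‖ζ + K (Gx (Px v))‖ ≤ ε * (3 * κ * (‖G₀‖ + 1)) * ‖v‖ := by
  have hε0 : 0 ≤ ε := (norm_nonneg _).trans hg
  have hκ0 : 0 ≤ κ := (norm_nonneg _).trans hK
  have hGy1 : ‖Gy‖ ≤ ‖G₀‖ + 1 := by
    have := norm_add_le (Gy - G₀) G₀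
    rw [sub_add_cancel] at this; linarith
  have hGx1 : ‖Gx‖ ≤ ‖G₀‖ + 1 := by
    have := norm_add_le (Gx - G₀) G₀
    rw [sub_add_cancel] at this; linarith
  have hDK : ‖D (K g)‖ ≤ p * ‖v‖ * (κ * ε) := D.le_of_opNorm_le_of_le hD
    (K.le_of_opNorm_le_of_le hK hg)
  have hKG : ‖K (G₀ v)‖ ≤ κ * (‖G₀‖ * ‖v‖) := K.le_of_opNorm_le_of_le hK (G₀.le_opNorm v)
  have hvx : ‖v - Px v‖ ≤ 2 * ε * ‖v‖ := by
    have : v - Px v = (Py - P₀) v - (Px - P₀) v := by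
      simp only [sub_apply, hv]; abel
    rw [this]
    refine (norm_sub_le _ _).trans ?_
    have h1 := (Py - P₀).le_of_opNorm_le hPy₀ v
    have h2 := (Px - P₀).le_of_opNorm_le hPx₀ v
    linarith
  refine ⟨?_, ?_, hvx, ?_⟩
  · have : z - ζ = -((Py - P₀) (K (G₀ v)) + Py (K ((Gy - G₀) v)) + D (K g)) := by
      simp only [hz, hζ, sub_apply, map_sub]; abel
    rw [this, norm_neg]
    have h1 : ‖(Py - P₀) (K (G₀ v))‖ ≤ ε * (κ * (‖G₀‖ * ‖v‖)) :=
      (Py - P₀).le_of_opNorm_le_of_le hPy₀ hKG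
    have h2 : ‖Py (K ((Gy - G₀) v))‖ ≤ 1 * (κ * (ε * ‖v‖)) :=
      Py.le_of_opNorm_le_of_le hPy (K.le_of_opNorm_le_of_le hK ((Gy - G₀).le_of_opNorm_le hGy v))
    calc _ ≤ ε * (κ * (‖G₀‖ * ‖v‖)) + 1 * (κ * (ε * ‖v‖)) + p * ‖v‖ * (κ * ε) :=
          (norm_add₃_le).trans (add_le_add (add_le_add h1 h2) hDK)
      _ = _ := by ring
  · rw [hz, norm_neg]
    have h2 : ‖Py (K (Gy v))‖ ≤ 1 * (κ * ((‖G₀‖ + 1) * ‖v‖)) :=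
      Py.le_of_opNorm_le_of_le hPy (K.le_of_opNorm_le_of_le hK (Gy.le_of_opNorm_le hGy1 v))
    have h3 : p * ‖v‖ * (κ * ε) ≤ p * ‖v‖ * (κ * 1) := by gcongr
    calc _ ≤ 1 * (κ * ((‖G₀‖ + 1) * ‖v‖)) + p * ‖v‖ * (κ * 1) :=
          (norm_add_le _ _).trans (add_le_add h2 (hDK.trans h3))
      _ = _ := by ring
  · have : ζ + K (Gx (Px v)) =
        (Px - P₀) (K (G₀ v)) + K ((Gx - G₀) v) + -K (Gx (v - Px v)) := by
      simp only [hζ, sub_apply, map_sub, hPK]; abel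
    rw [this]
    have h1 : ‖(Px - P₀) (K (G₀ v))‖ ≤ ε * (κ * (‖G₀‖ * ‖v‖)) :=
      (Px - P₀).le_of_opNorm_le_of_le hPx₀ hKG
    have h2 : ‖K ((Gx - G₀) v)‖ ≤ κ * (ε * ‖v‖) :=
      K.le_of_opNorm_le_of_le hK ((Gx - G₀).le_of_opNorm_le hGx v)
    have h3 : ‖-K (Gx (v - Px v))‖ ≤ κ * ((‖G₀‖ + 1) * (2 * ε * ‖v‖)) := by
      rw [norm_neg]
      exact K.le_of_opNorm_le_of_le hK (Gx.le_of_opNorm_le_of_le hGx1 hvx)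
    calc _ ≤ ε * (κ * (‖G₀‖ * ‖v‖)) + κ * (ε * ‖v‖) + κ * ((‖G₀‖ + 1) * (2 * ε * ‖v‖)) :=
          (norm_add₃_le).trans (add_le_add (add_le_add h1 h2) h3)
      _ = _ := by ring

end Velocity

end CSD

/-- The derivative of a `C¹` map is locally bounded. -/
theorem ContDiffAt.exists_norm_fderiv_apply_le {X Y : Type*} [NormedAddCommGroup X]
    [NormedSpace ℝ X] [NormedAddCommGroup Y] [NormedSpace ℝ Y] {F : X → Y} {x : X}
    (h : ContDiffAt ℝ 1 F x) :
    ∃ p, 0 ≤ p ∧ ∀ᶠ y in 𝓝 x, ∀ v, ‖fderiv ℝ F y v‖ ≤ p * ‖v‖ := by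
  have hc : ContinuousAt (fderiv ℝ F) x := (h.fderiv_right (m := 0) (by simp)).continuousAt
  refine ⟨‖fderiv ℝ F x‖ + 1, by positivity, ?_⟩
  filter_upwards [hc.norm.eventually (gt_mem_nhds (lt_add_one _))] with y hy v
  exact (fderiv ℝ F y).le_of_opNorm_le hy.le v

namespace CSD

/-! ### The step map and its action on curves -/

theorem derivWithin_mem_tangentSpace {d m : ℕ} {c : Fin m → E d → ℝ}
    (hc : ∀ i, ContDiff ℝ ∞ (c i)) {γ : ℝ → E d} (hγM : MapsTo γ (Icc 0 1) (feasible c))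
    {t : ℝ} (ht : t ∈ Icc (0 : ℝ) 1) {v : E d} (hv : HasDerivWithinAt γ v (Icc 0 1) t) :
    v ∈ tangentSpace c (γ t) := by
  rw [mem_tangentSpace_iff]
  funext i
  have h1 : HasDerivWithinAt (c i ∘ γ) (fderiv ℝ (c i) (γ t) v) (Icc 0 1) t :=
    (((hc i).differentiable (by simp)) (γ t)).hasFDerivAt.comp_hasDerivWithinAt t hv
  have h2 : HasDerivWithinAt (c i ∘ γ) 0 (Icc 0 1) t :=
    (hasDerivWithinAt_const t _ (0 : ℝ)).congr (fun s hs => hγM hs i) (hγM ht i)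
  exact (uniqueDiffOn_Icc zero_lt_one t ht).eq_deriv _ h1 h2

/-- The extension `(I - 2 Q) P(x)` of `I - 2 Q` to the ambient space. -/
noncomputable def reflOp {d m : ℕ} (c : Fin m → E d → ℝ) (x : E d)
    (Q : tangentSpace c x →L[ℝ] tangentSpace c x) : E d →L[ℝ] E d :=
  (tangentSpace c x).subtypeL ∘L (ContinuousLinearMap.id ℝ _ - (2 : ℝ) • Q) ∘L
    (tangentSpace c x).orthogonalProjectionOnto

theorem reflOp_apply {d m : ℕ} (c : Fin m → E d → ℝ) (x : E d)
    (Q : tangentSpace c x →L[ℝ] tangentSpace c x) (w : E d) :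
    reflOp c x Q w = (((tangentSpace c x).orthogonalProjectionOnto w -
      (2 : ℝ) • Q ((tangentSpace c x).orthogonalProjectionOnto w) : tangentSpace c x) : E d) := rfl

theorem reflOp_mem {d m : ℕ} (c : Fin m → E d → ℝ) (x : E d)
    (Q : tangentSpace c x →L[ℝ] tangentSpace c x) (w : E d) :
    reflOp c x Q w ∈ tangentSpace c x := Subtype.coe_prop _

theorem norm_reflOp_le {d m : ℕ} (c : Fin m → E d → ℝ) (f : E d → ℝ) (x : E d)
    {Q : tangentSpace c x →L[ℝ] tangentSpace c x} {θ : ℝ} (hQ : ‖Q - unstableProj c f x‖ ≤ θ) :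
    ‖reflOp c x Q‖ ≤ 3 + 2 * θ := by
  have hQ1 : ‖Q‖ ≤ 1 + θ := by
    have h1 : ‖unstableProj c f x‖ ≤ 1 := Submodule.starProjection_norm_le _
    have h2 := norm_add_le (Q - unstableProj c f x) (unstableProj c f x)
    rw [sub_add_cancel] at h2
    linarith
  refine ContinuousLinearMap.opNorm_le_bound _ (by linarith [norm_nonneg (Q - unstableProj c f x)])
    fun w => ?_
  set u := (tangentSpace c x).orthogonalProjectionOnto w with hu
  have hu1 : ‖u‖ ≤ ‖w‖ := Submodule.norm_orthogonalProjectionOnto_apply_le _ _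
  rw [reflOp_apply, ← Submodule.coe_norm]
  have h3 : ‖Q u‖ ≤ (1 + θ) * ‖w‖ := Q.le_of_opNorm_le_of_le hQ1 hu1
  refine (norm_sub_le _ _).trans ?_
  rw [norm_smul, Real.norm_of_nonneg zero_le_two]
  linarith

/-- The step `y ↦ Ret_y(-s P(y) K grad f(y))`, extended from the current iterate to all of `M` by
freezing the operator `K` and projecting onto the tangent spaces. -/
noncomputable def stepMap {d m : ℕ} (c : Fin m → E d → ℝ) (f : E d → ℝ) (Ret : E d → E d → E d)
    (s : ℝ) (K : E d →L[ℝ] E d) (y : E d) : E d :=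
  Ret y ((-s) • (tangentSpace c y).starProjection (K (riemGrad c f y)))

theorem smul_starProjection_mem {d m : ℕ} (c : Fin m → E d → ℝ) (y w : E d) (a : ℝ) :
    a • (tangentSpace c y).starProjection w ∈ tangentSpace c y :=
  Submodule.smul_mem _ _ (Submodule.starProjection_apply_mem _ _)

theorem stepMap_mem {d m : ℕ} {c : Fin m → E d → ℝ} {Ret : E d → E d → E d}
    (hRet : IsRetraction c Ret) (f : E d → ℝ) (s : ℝ) (K : E d →L[ℝ] E d) {y : E d}
    (hy : y ∈ feasible c) : stepMap c f Ret s K y ∈ feasible c :=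
  hRet.mem y hy _ (smul_starProjection_mem c y _ _)

theorem stepMap_of_riemGrad_eq_zero {d m : ℕ} {c : Fin m → E d → ℝ} {Ret : E d → E d → E d}
    (hRet : IsRetraction c Ret) {f : E d → ℝ} (s : ℝ) (K : E d →L[ℝ] E d) {y : E d}
    (hy : y ∈ feasible c) (h : riemGrad c f y = 0) : stepMap c f Ret s K y = y := by
  simp [stepMap, h, hRet.map_zero y hy]

theorem stepMap_reflOp_self {d m : ℕ} (c : Fin m → E d → ℝ) (f : E d → ℝ) (Ret : E d → E d → E d)
    (s : ℝ) (x : E d) (Q : tangentSpace c x →L[ℝ] tangentSpace c x) :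
    stepMap c f Ret s (reflOp c x Q) x =
      Ret x ((-s) • (riemGrad c f x - (2 : ℝ) • Q (riemGrad c f x)) : tangentSpace c x) := by
  have h : (tangentSpace c x).orthogonalProjectionOnto (riemGrad c f x : E d) = riemGrad c f x :=
    Submodule.orthogonalProjectionOnto_mem_subspace_eq_self _
  rw [stepMap, Submodule.starProjection_eq_self_iff.2 (reflOp_mem c x Q _), reflOp_apply, h,
    Submodule.coe_smul]

/-- The search direction field is differentiable, with derivative given by the product rule. -/
theorem hasFDerivAt_direction {d m : ℕ} {c : Fin m → E d → ℝ}
    (hc : ∀ i, ContDiff ℝ ∞ (c i)) {f : E d → ℝ} (hf : ContDiff ℝ ∞ f) {y : E d}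
    (h : LinearIndependent ℝ fun i => gradient (c i) y) (s : ℝ) (K : E d →L[ℝ] E d) :
    ∃ η' : E d →L[ℝ] E d,
      HasFDerivAt (fun y => (-s) • (tangentSpace c y).starProjection (K (riemGrad c f y))) η' y ∧
      ∀ v, η' v = s • -((tangentSpace c y).starProjection
          (K (fderiv ℝ (fun y => (riemGrad c f y : E d)) y v)) +
        fderiv ℝ (fun y => (tangentSpace c y).starProjection) y v (K (riemGrad c f y))) := by
  have hP := ((contDiffAt_starProjection_tangentSpace hc h).differentiableAt (by simp)).hasFDerivAt
  have hg := ((contDiffAt_riemGrad hc hf h).differentiableAt (by simp)).hasFDerivAt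
  refine ⟨_, (hP.clm_apply (K.hasFDerivAt.comp y hg)).const_smul (-s), fun v => ?_⟩
  rw [smul_neg, ← neg_smul]
  rfl

theorem contDiffAt_direction {d m : ℕ} {c : Fin m → E d → ℝ}
    (hc : ∀ i, ContDiff ℝ ∞ (c i)) {f : E d → ℝ} (hf : ContDiff ℝ ∞ f) {y : E d}
    (h : LinearIndependent ℝ fun i => gradient (c i) y) (s : ℝ) (K : E d →L[ℝ] E d) :
    ContDiffAt ℝ ∞ (fun y => (-s) • (tangentSpace c y).starProjection (K (riemGrad c f y))) y :=
  contDiffAt_const.fun_smul ((contDiffAt_starProjection_tangentSpace hc h).clm_apply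
    (K.contDiff.contDiffAt.comp y (contDiffAt_riemGrad hc hf h)))

theorem contDiffOn_stepMap_comp {d m : ℕ} {c : Fin m → E d → ℝ}
    (hc : ∀ i, ContDiff ℝ ∞ (c i)) (hLICQ : LICQ c) {f : E d → ℝ} (hf : ContDiff ℝ ∞ f)
    {Ret : E d → E d → E d} (hRet : IsRetraction c Ret) (s : ℝ) (K : E d →L[ℝ] E d) {γ : ℝ → E d}
    (hγ : ContDiffOn ℝ 1 γ (Icc 0 1)) (hγM : MapsTo γ (Icc 0 1) (feasible c)) :
    ContDiffOn ℝ 1 (stepMap c f Ret s K ∘ γ) (Icc 0 1) := by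
  have h1 : ContDiffOn ℝ 1 (fun t => (γ t, (-s) • (tangentSpace c (γ t)).starProjection
      (K (riemGrad c f (γ t))))) (Icc 0 1) := by
    refine hγ.prodMk fun t ht => ?_
    exact ((contDiffAt_direction hc hf (hLICQ _ (hγM ht)) s K).of_le
      ENat.LEInfty.out).comp_contDiffWithinAt t (hγ t ht)
  exact (hRet.smooth.of_le ENat.LEInfty.out).comp h1
    fun t ht => ⟨hγM ht, smul_starProjection_mem c _ _ _⟩

theorem norm_sub_smul_reflOp_le {d m k : ℕ} {f : E d → ℝ} (hf : ContDiff ℝ ∞ f)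
    {c : Fin m → E d → ℝ} (hc : ∀ i, ContDiff ℝ ∞ (c i)) (hLICQ : LICQ c)
    {xs : E d} {δ μ L : ℝ} (hsaddle : IsStrictSaddle c f k xs δ μ L) {θ : ℝ}
    {x : E d} (hx : x ∈ feasible c) (hxδ : geoDist (feasible c) x xs < ENNReal.ofReal δ)
    {Q : tangentSpace c x →L[ℝ] tangentSpace c x} (hQ : ‖Q - unstableProj c f x‖ ≤ θ)
    {s : ℝ} (hs : 0 < s) (hsL : s * L ≤ 1) {u : E d} (hu : u ∈ tangentSpace c x) :
    ‖u - s • reflOp c x Q (fderiv ℝ (fun y => (riemGrad c f y : E d)) x u)‖ ≤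
      (1 - s * (μ - 2 * θ * L)) * ‖u‖ :=
  norm_sub_smul_le (isSymmetric_riemHess hc hf (hLICQ x hx)) hsaddle.mu_pos hsaddle.mu_lt
    (hsaddle.eigenvalue_mem x hx hxδ) hQ hs hsL ⟨u, hu⟩

set_option maxHeartbeats 1000000 in
/-- Near the saddle the step map shrinks the velocity of every `C¹` curve in `M`, uniformly in the
current iterate, the step size and the inexact projector. -/
theorem exists_norm_derivWithin_stepMap_comp_le {d m k : ℕ} {f : E d → ℝ} (hf : ContDiff ℝ ∞ f)
    {c : Fin m → E d → ℝ} (hc : ∀ i, ContDiff ℝ ∞ (c i)) (hLICQ : LICQ c)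
    {Ret : E d → E d → E d} (hRet : IsRetraction c Ret)
    {xs : E d} {δ μ L : ℝ} (hsaddle : IsStrictSaddle c f k xs δ μ L)
    {θ : ℝ} (hθ₀ : 0 ≤ θ) (hθ : θ < μ / (2 * L)) :
    ∃ ρ > 0, ∀ x ∈ feasible c, ‖x - xs‖ < ρ →
      geoDist (feasible c) x xs < ENNReal.ofReal δ →
      ∀ Q : tangentSpace c x →L[ℝ] tangentSpace c x, ‖Q - unstableProj c f x‖ ≤ θ →
      ∀ s : ℝ, 0 < s → s ≤ 1 / L → ∀ γ : ℝ → E d, ContDiffOn ℝ 1 γ (Icc 0 1) →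
      MapsTo γ (Icc 0 1) (feasible c) → (∀ t ∈ Icc (0 : ℝ) 1, ‖γ t - xs‖ < ρ) →
      ∀ t ∈ Icc (0 : ℝ) 1,
        ‖derivWithin (stepMap c f Ret s (reflOp c x Q) ∘ γ) (Icc 0 1) t‖ ≤
          (1 - s * L * (μ / (2 * L) - θ)) * ‖derivWithin γ (Icc 0 1) t‖ := by
  have hμ := hsaddle.mu_pos
  have hL : 0 < L := hμ.trans hsaddle.mu_lt
  have hxs := hsaddle.mem
  obtain ⟨F', C, hC, hFv, hF⟩ := hRet.exists_hasFDerivWithinAt hxs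
  set P : E d → E d →L[ℝ] E d := fun y => (tangentSpace c y).starProjection with hPdef
  set g : E d → E d := fun y => (riemGrad c f y : E d) with hgdef
  have hPs : ContDiffAt ℝ ∞ P xs := contDiffAt_starProjection_tangentSpace hc (hLICQ xs hxs)
  have hgs : ContDiffAt ℝ ∞ g xs := contDiffAt_riemGrad hc hf (hLICQ xs hxs)
  obtain ⟨p, hp, hpP⟩ := (hPs.of_le ENat.LEInfty.out).exists_norm_fderiv_apply_le
  have hg'c : ContinuousAt (fderiv ℝ g) xs :=
    (hgs.fderiv_right (m := ∞) (by norm_cast)).continuousAt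
  -- `κ` bounds the norm of `K = (I - 2 Q) P(x)`
  set κ := 3 + 2 * θ with hκ
  have hκ0 : 0 < κ := by positivity
  set G := ‖fderiv ℝ g xs‖ with hG
  set β := L * (μ / (2 * L) - θ) with hβdef
  have hβ : 0 < β := mul_pos hL (by linarith)
  have hβ2 : β = μ / 2 - L * θ := by rw [hβdef]; field_simp
  set b := ‖F' (xs, 0)‖ with hb
  -- the sum of all error constants; `ε` makes the total error at most the spare gain `β`
  set T := C * κ + κ * (p + G + 1) * (1 + b) + 4 * β + 3 * κ * (G + 1) with hT
  have hTpos : 0 < T := by positivity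
  set ε := min 1 (β / T) with hεdef
  have hε : 0 < ε := lt_min one_pos (div_pos hβ hTpos)
  have hε1 : ε ≤ 1 := min_le_left _ _
  have hεT : ε * T ≤ β := by
    rw [← le_div_iff₀ hTpos]; exact min_le_right _ _
  obtain ⟨r, hr, hFr⟩ := hF ε hε
  have hgxs : g xs = 0 := by simp [hgdef, hsaddle.critical]
  have hnear : ∀ᶠ y in 𝓝 xs, ‖P y - P xs‖ ≤ ε ∧ ‖fderiv ℝ g y - fderiv ℝ g xs‖ ≤ ε ∧
      (∀ v, ‖fderiv ℝ P y v‖ ≤ p * ‖v‖) ∧ ‖g y‖ ≤ ε ∧ ‖g y‖ < r * L / κ ∧ ‖y - xs‖ < r := by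
    have e1 : ∀ᶠ y in 𝓝 xs, ‖P y - P xs‖ < ε := by
      simpa [dist_eq_norm] using hPs.continuousAt.eventually (Metric.ball_mem_nhds _ hε)
    have e2 : ∀ᶠ y in 𝓝 xs, ‖fderiv ℝ g y - fderiv ℝ g xs‖ < ε := by
      simpa [dist_eq_norm] using hg'c.eventually (Metric.ball_mem_nhds _ hε)
    have e4 : ∀ e > 0, ∀ᶠ y in 𝓝 xs, ‖g y‖ < e := fun e he =>
      hgs.continuousAt.norm.eventually (gt_mem_nhds (by simpa [hgxs] using he))
    have e5 : ∀ᶠ y in 𝓝 xs, ‖y - xs‖ < r := by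
      filter_upwards [Metric.ball_mem_nhds xs hr] with y hy
      rwa [mem_ball_iff_norm] at hy
    filter_upwards [e1, e2, hpP, e4 ε hε, e4 (r * L / κ) (by positivity), e5] with y h1 h2 h3 h4 h5 h6
    exact ⟨h1.le, h2.le, h3, h4.le, h5, h6⟩
  obtain ⟨ρ, hρ, hball⟩ := Metric.eventually_nhds_iff.1 hnear
  simp only [dist_eq_norm] at hball
  refine ⟨ρ, hρ, fun x hx hxρ hxδ Q hQ s hs hsL γ hγ hγM hγρ t ht => ?_⟩
  obtain ⟨hPx, hGx, -, -, -, -⟩ := hball hxρ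
  obtain ⟨hPy, hGy, hP'y, hgy, hgy2, hyr⟩ := hball (hγρ t ht)
  have hsL1 : s * L ≤ 1 := by rwa [le_div_iff₀ hL] at hsL
  have hy := hγM ht
  set K := reflOp c x Q with hKdef
  have hKn : ‖K‖ ≤ κ := norm_reflOp_le c f x hQ
  set y := γ t with hydef
  set v := derivWithin γ (Icc 0 1) t with hv
  have hγd : HasDerivWithinAt γ v (Icc 0 1) t :=
    ((hγ t ht).differentiableWithinAt (by simp)).hasDerivWithinAt
  have hvT : v ∈ tangentSpace c y := derivWithin_mem_tangentSpace hc hγM ht hγd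
  set η : E d → E d := fun y => (-s) • P y (K (g y)) with hη
  have hηT : ∀ y, η y ∈ tangentSpace c y := fun y => smul_starProjection_mem c y _ _
  have hηn : ‖η y‖ ≤ s * (κ * ‖g y‖) := by
    rw [hη, norm_smul, norm_neg, Real.norm_of_nonneg hs.le]
    gcongr
    exact (Submodule.norm_starProjection_apply_le _ _).trans (K.le_of_opNorm_le hKn _)
  have hηr : ‖η y‖ < r := by
    refine hηn.trans_lt ?_
    calc s * (κ * ‖g y‖) ≤ 1 / L * (κ * ‖g y‖) := by gcongr
      _ < 1 / L * (κ * (r * L / κ)) := by gcongr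
      _ = r := by field_simp
  obtain ⟨hA, hAB, hAA₀⟩ := hFr y hy (η y) (hηT y) hyr hηr
  obtain ⟨hA₀, -, -⟩ := hFr y hy 0 (Submodule.zero_mem _) hyr (by simpa using hr)
  obtain ⟨η', hη', hη'v⟩ := hasFDerivAt_direction hc hf (hLICQ y hy) s K
  -- horizontal vectors are fixed along the zero section, since `Ret y 0 = y` on `M`
  have hA₀v : F' (y, 0) (v, 0) = v := by
    have h1 : HasDerivWithinAt (fun t => (γ t, (0 : E d))) (v, (0 : E d)) (Icc 0 1) t :=
      hγd.prodMk (hasDerivWithinAt_const _ _ _)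
    have h2 := hA₀.comp_hasDerivWithinAt t h1
      (fun t' ht' => show (γ t', (0 : E d)) ∈ tangentBundle c from ⟨hγM ht', Submodule.zero_mem _⟩)
    have h3 := hγd.congr (f₁ := (fun p : E d × E d => Ret p.1 p.2) ∘ fun t => (γ t, (0 : E d)))
      (fun t' ht' => hRet.map_zero _ (hγM ht')) (hRet.map_zero _ hy)
    exact (uniqueDiffOn_Icc zero_lt_one t ht).eq_deriv _ h2 h3
  set z := -(P y (K (fderiv ℝ g y v)) + fderiv ℝ P y v (K (g y))) with hz
  set ζ := -P xs (K (fderiv ℝ g xs v)) with hζ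
  have hderiv : derivWithin (stepMap c f Ret s K ∘ γ) (Icc 0 1) t = F' (y, η y) (v, s • z) := by
    have h1 : HasDerivWithinAt (fun t => (γ t, η (γ t))) (v, s • z) (Icc 0 1) t := by
      refine hγd.prodMk ?_
      rw [hz, ← hη'v]
      exact hη'.comp_hasDerivWithinAt t hγd
    have h2 := hA.comp_hasDerivWithinAt t h1
      (fun t' ht' => show (γ t', η (γ t')) ∈ tangentBundle c from ⟨hγM ht', hηT _⟩)
    exact h2.derivWithin (uniqueDiffOn_Icc zero_lt_one t ht)
  have hζT : ζ ∈ tangentSpace c xs :=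
    Submodule.neg_mem _ (Submodule.starProjection_apply_mem _ _)
  obtain ⟨b1, b2, b3, b4⟩ := norm_direction_deriv_le (P₀ := P xs) (Px := P x) (Py := P y)
    (G₀ := fderiv ℝ g xs) (Gx := fderiv ℝ g x) (Gy := fderiv ℝ g y) (K := K)
    (D := fderiv ℝ P y v) (g := g y) (v := v) (z := z) (ζ := ζ) hε1
    (Submodule.starProjection_norm_le _) hPx hPy hGx hGy hKn (hP'y v) hgy
    (Submodule.starProjection_eq_self_iff.2 hvT)
    (fun w => Submodule.starProjection_eq_self_iff.2 (reflOp_mem c x Q w)) hz hζ hp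
  have a1 : ‖F' (y, η y) (v, s • z) - (v + s • ζ)‖ ≤
      s * (C * (κ * ε) * ‖v‖ + ε * ‖z‖ + b * ‖z - ζ‖) := by
    refine norm_apply_prod_sub_le hs.le hA₀v (hFv ζ hζT) (hAA₀.trans ?_) hAB
    gcongr
    exact hηn.trans (by gcongr)
  have hsβ : 2 * (s * β) ≤ 1 := by
    have h1 : β ≤ L / 2 := by linarith [mul_nonneg hL.le hθ₀, hsaddle.mu_lt]
    linarith [mul_le_mul_of_nonneg_left h1 hs.le]
  have a2 : ‖v - s • K (fderiv ℝ g x (P x v))‖ ≤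
      (1 - 2 * (s * β)) * ‖v‖ + 2 * (s * β) * ‖v - P x v‖ := by
    refine norm_sub_apply_starProjection_le (N := fun u => s • K (fderiv ℝ g x u))
      (by positivity) hsβ (fun u _ => Submodule.smul_mem _ _ (reflOp_mem c x Q _))
      (fun u hu => (norm_sub_smul_reflOp_le hf hc hLICQ hsaddle hx hxδ hQ hs hsL1 hu).trans_eq ?_) v
    rw [hβ2]; ring
  have hdec : F' (y, η y) (v, s • z) = (F' (y, η y) (v, s • z) - (v + s • ζ)) +
      (v - s • K (fderiv ℝ g x (P x v))) + s • (ζ + K (fderiv ℝ g x (P x v))) := by module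
  rw [hderiv, hdec]
  calc _ ≤ s * (C * (κ * ε) * ‖v‖ + ε * ‖z‖ + b * ‖z - ζ‖) +
        ((1 - 2 * (s * β)) * ‖v‖ + 2 * (s * β) * ‖v - P x v‖) +
        s * ‖ζ + K (fderiv ℝ g x (P x v))‖ := by
        refine norm_add₃_le.trans (add_le_add (add_le_add a1 a2) ?_)
        rw [norm_smul, Real.norm_of_nonneg hs.le]
    _ ≤ s * (C * (κ * ε) * ‖v‖ + ε * (κ * (p + G + 1) * ‖v‖) + b * (ε * (κ * (p + G + 1)) * ‖v‖)) +
        ((1 - 2 * (s * β)) * ‖v‖ + 2 * (s * β) * (2 * ε * ‖v‖)) +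
        s * (ε * (3 * κ * (G + 1)) * ‖v‖) := by gcongr
    _ = (1 - 2 * (s * β) + s * (ε * T)) * ‖v‖ := by rw [hT]; ring
    _ ≤ (1 - 2 * (s * β) + s * β) * ‖v‖ := by gcongr
    _ = _ := by rw [hβdef]; ring

/-! ### Geodesic distance -/

theorem enorm_sub_le_curveLength {d : ℕ} {γ : ℝ → E d} (hγ : ContDiffOn ℝ 1 γ (Icc 0 1))
    {t : ℝ} (ht : t ∈ Icc (0 : ℝ) 1) : ‖γ 1 - γ t‖ₑ ≤ curveLength γ := by
  refine (enorm_sub_le_lintegral_deriv_of_contDiffOn_Icc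
    (hγ.mono (Icc_subset_Icc_left ht.1)) ht.2).trans ?_
  refine (MeasureTheory.lintegral_mono_set (Icc_subset_Icc_left ht.1)).trans_eq ?_
  apply MeasureTheory.lintegral_congr_ae
  rw [← MeasureTheory.restrict_Ioo_eq_restrict_Icc]
  filter_upwards [MeasureTheory.self_mem_ae_restrict measurableSet_Ioo] with x hx
  rw [derivWithin_of_mem_nhds (Icc_mem_nhds hx.1 hx.2)]

theorem curveLength_le_mul {d : ℕ} {γ σ : ℝ → E d} {q : ℝ} (hq : 0 ≤ q)
    (h : ∀ t ∈ Icc (0 : ℝ) 1,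
      ‖derivWithin σ (Icc 0 1) t‖ ≤ q * ‖derivWithin γ (Icc 0 1) t‖) :
    curveLength σ ≤ ENNReal.ofReal q * curveLength γ := by
  rw [curveLength, curveLength, ← MeasureTheory.lintegral_const_mul' _ _ ENNReal.ofReal_ne_top]
  refine MeasureTheory.setLIntegral_mono' measurableSet_Icc fun t ht => ?_
  rw [← ofReal_norm, ← ofReal_norm, ← ENNReal.ofReal_mul hq]
  exact ENNReal.ofReal_le_ofReal (h t ht)

theorem curveLength_le_ofReal {d : ℕ} {γ : ℝ → E d} {C : ℝ}
    (h : ∀ t ∈ Icc (0 : ℝ) 1, ‖derivWithin γ (Icc 0 1) t‖ ≤ C) :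
    curveLength γ ≤ ENNReal.ofReal C := by
  calc curveLength γ ≤ ∫⁻ _ in Icc (0 : ℝ) 1, ENNReal.ofReal C := by
        refine MeasureTheory.setLIntegral_mono' measurableSet_Icc fun t ht => ?_
        rw [← ofReal_norm]
        exact ENNReal.ofReal_le_ofReal (h t ht)
    _ = ENNReal.ofReal C := by simp

theorem geoDist_le_curveLength {d : ℕ} {M : Set (E d)} {γ : ℝ → E d}
    (hγ : ContDiffOn ℝ 1 γ (Icc 0 1)) (hM : MapsTo γ (Icc 0 1) M) :
    geoDist M (γ 0) (γ 1) ≤ curveLength γ :=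
  iInf₂_le γ ⟨hγ, hM, rfl, rfl⟩

theorem enorm_sub_le_geoDist {d : ℕ} (M : Set (E d)) (x y : E d) :
    ‖x - y‖ₑ ≤ geoDist M x y := by
  refine le_iInf₂ fun γ hγ => ?_
  obtain ⟨h1, -, rfl, rfl⟩ := hγ
  rw [← enorm_neg, neg_sub]
  exact enorm_sub_le_curveLength h1 (by simp)

/-- The map that straightens `M` near `xs`: its tangential part is the displacement from `xs`, its
normal part records the values of the constraints. -/
noncomputable def straighten {d m : ℕ} (c : Fin m → E d → ℝ) (xs y : E d) : E d :=
  (tangentSpace c xs).starProjection (y - xs) + gradientComb c xs (fun i => c i y)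

theorem straighten_mem_iff {d m : ℕ} {c : Fin m → E d → ℝ} {xs : E d}
    (h : LinearIndependent ℝ fun i => gradient (c i) xs) (y : E d) :
    straighten c xs y ∈ tangentSpace c xs ↔ y ∈ feasible c := by
  rw [straighten, Submodule.add_mem_iff_right _ (Submodule.starProjection_apply_mem _ _),
    mem_tangentSpace_iff]
  constructor
  · intro h1
    exact fun i => congrFun (eq_zero_of_constraintDeriv_gradientComb h h1) i
  · intro h1
    have : (fun i => c i y) = 0 := funext h1
    rw [this, map_zero, map_zero]

theorem contDiff_straighten {d m : ℕ} {c : Fin m → E d → ℝ} (hc : ∀ i, ContDiff ℝ ∞ (c i))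
    (xs : E d) : ContDiff ℝ ∞ (straighten c xs) :=
  ((tangentSpace c xs).starProjection.contDiff.comp (contDiff_id.sub contDiff_const)).add
    ((gradientComb c xs).contDiff.comp (contDiff_pi.2 hc))

theorem exists_hasFDerivAt_straighten {d m : ℕ} {c : Fin m → E d → ℝ}
    (hc : ∀ i, ContDiff ℝ ∞ (c i)) {xs : E d}
    (h : LinearIndependent ℝ fun i => gradient (c i) xs) :
    ∃ e : E d ≃L[ℝ] E d, HasFDerivAt (straighten c xs) (e : E d →L[ℝ] E d) xs := by
  set A : E d →L[ℝ] E d :=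
    (tangentSpace c xs).starProjection + gradientComb c xs ∘L constraintDeriv c xs with hA
  have hd : HasFDerivAt (straighten c xs) A xs := by
    have h1 : HasFDerivAt (fun y => (tangentSpace c xs).starProjection (y - xs))
        (tangentSpace c xs).starProjection xs := by
      have := (tangentSpace c xs).starProjection.hasFDerivAt.comp xs
        ((hasFDerivAt_id xs).sub_const xs)
      rwa [ContinuousLinearMap.comp_id] at this
    have h2 : HasFDerivAt (fun y i => c i y) (constraintDeriv c xs) xs :=
      hasFDerivAt_pi.2 fun i => (((hc i).differentiable (by simp)) xs).hasFDerivAt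
    exact h1.add ((gradientComb c xs).hasFDerivAt.comp xs h2)
  have hinj : Function.Injective A := by
    rw [injective_iff_map_eq_zero]
    intro v hv
    have hP := Submodule.starProjection_apply_mem (tangentSpace c xs) v
    have h1 : constraintDeriv c xs (A v) = 0 := by rw [hv, map_zero]
    have h2 : constraintDeriv c xs ((tangentSpace c xs).starProjection v) = 0 :=
      (mem_tangentSpace_iff c xs _).1 hP
    have h3 : constraintDeriv c xs (gradientComb c xs (constraintDeriv c xs v)) = 0 := by
      have : A v = (tangentSpace c xs).starProjection v +
        gradientComb c xs (constraintDeriv c xs v) := rfl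
      rwa [this, map_add, h2, zero_add] at h1
    have h4 := eq_zero_of_constraintDeriv_gradientComb h h3
    have h5 : A v = (tangentSpace c xs).starProjection v +
        gradientComb c xs (constraintDeriv c xs v) := rfl
    rwa [hv, h4, map_zero, add_zero, Submodule.starProjection_eq_self_iff.2
      ((mem_tangentSpace_iff c xs v).2 h4), eq_comm] at h5
  refine ⟨(LinearEquiv.ofInjectiveEndo A.toLinearMap hinj).toContinuousLinearEquiv, ?_⟩
  convert hd using 1
  ext1 v
  rfl

/-- The geodesic distance to `xs` is continuous at `xs`: in straightened coordinates a segment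
joins a nearby point of `M` to `xs`. -/
theorem eventually_geoDist_lt {d m : ℕ} {c : Fin m → E d → ℝ} (hc : ∀ i, ContDiff ℝ ∞ (c i))
    {xs : E d} (hxs : xs ∈ feasible c) (h : LinearIndependent ℝ fun i => gradient (c i) xs)
    {a : ℝ≥0∞} (ha : 0 < a) : ∀ᶠ y in 𝓝[feasible c] xs, geoDist (feasible c) y xs < a := by
  obtain ⟨e, he⟩ := exists_hasFDerivAt_straighten hc h
  have hΨ : ContDiffAt ℝ ∞ (straighten c xs) xs := (contDiff_straighten hc xs).contDiffAt
  have hΨ0 : straighten c xs xs = 0 := by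
    have : (fun i => c i xs) = 0 := funext hxs
    simp [straighten, this]
  set G := hΨ.localInverse he (by simp) with hG
  have hGs : ContDiffAt ℝ ∞ G 0 := by
    have := hΨ.to_localInverse he (by simp)
    rwa [hΨ0] at this
  have hG0 : G 0 = xs := by
    have := hΨ.localInverse_apply_image he (by simp)
    rwa [hΨ0] at this
  have hleft : ∀ᶠ y in 𝓝 xs, G (straighten c xs y) = y :=
    (hΨ.hasStrictFDerivAt' he (by simp)).eventually_left_inverse
  have hright : ∀ᶠ w in 𝓝 (0 : E d), straighten c xs (G w) = w := by
    have := (hΨ.hasStrictFDerivAt' he (by simp)).eventually_right_inverse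
    rwa [hΨ0] at this
  have hG1 : ContDiffAt ℝ 1 G 0 := hGs.of_le ENat.LEInfty.out
  obtain ⟨p, hp, hpG⟩ := hG1.exists_norm_fderiv_apply_le
  obtain ⟨r, hr, hball⟩ := Metric.eventually_nhds_iff.1
    (hright.and (hpG.and (hG1.eventually (by simp))))
  have hcont : Tendsto (straighten c xs) (𝓝 xs) (𝓝 0) := by
    simpa [hΨ0] using hΨ.continuousAt.tendsto
  have hsmall : ∀ᶠ y in 𝓝 xs, ENNReal.ofReal (p * ‖straighten c xs y‖) < a := by
    have h1 : Tendsto (fun y => ENNReal.ofReal (p * ‖straighten c xs y‖)) (𝓝 xs) (𝓝 0) := by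
      simpa using ENNReal.tendsto_ofReal ((hcont.norm).const_mul p)
    exact h1.eventually (gt_mem_nhds ha)
  have hin : ∀ᶠ y in 𝓝 xs, dist (straighten c xs y) 0 < r :=
    hcont.eventually (Metric.ball_mem_nhds _ hr)
  rw [eventually_nhdsWithin_iff]
  filter_upwards [hleft, hsmall, hin] with y h1 h2 h3 hy
  refine lt_of_le_of_lt ?_ h2
  set w := straighten c xs y with hw
  have hwT : w ∈ tangentSpace c xs := (straighten_mem_iff h y).2 hy
  set l : ℝ → E d := fun t => (1 - t) • w with hl
  have hld : ∀ t, HasDerivAt l (-w) t := fun t => by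
    simpa using ((hasDerivAt_id t).const_sub 1).smul_const w
  have hlr : ∀ t ∈ Icc (0 : ℝ) 1, dist (l t) 0 < r := fun t ht => by
    rw [dist_zero_right] at h3 ⊢
    refine lt_of_le_of_lt ?_ h3
    rw [hl, norm_smul, Real.norm_of_nonneg (by linarith [ht.2])]
    exact mul_le_of_le_one_left (norm_nonneg _) (by linarith [ht.1])
  have hγ : ContDiffOn ℝ 1 (G ∘ l) (Icc 0 1) := fun t ht =>
    (hball (hlr t ht)).2.2.comp_contDiffWithinAt t
      ((contDiff_const.sub contDiff_id).smul contDiff_const).contDiffWithinAt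
  have hM : MapsTo (G ∘ l) (Icc 0 1) (feasible c) := fun t ht => by
    rw [← straighten_mem_iff h, Function.comp_apply, (hball (hlr t ht)).1]
    exact Submodule.smul_mem _ _ hwT
  have hlen : curveLength (G ∘ l) ≤ ENNReal.ofReal (p * ‖w‖) := by
    refine curveLength_le_ofReal fun t ht => ?_
    have hd : HasDerivWithinAt (G ∘ l) (fderiv ℝ G (l t) (-w)) (Icc 0 1) t :=
      ((hball (hlr t ht)).2.2.differentiableAt (by simp)).hasFDerivAt.comp_hasDerivWithinAt t
        (hld t).hasDerivWithinAt
    rw [hd.derivWithin (uniqueDiffOn_Icc zero_lt_one t ht)]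
    simpa using (hball (hlr t ht)).2.1 (-w)
  have h0 : (G ∘ l) 0 = y := by simp [hl, h1]
  have h01 : (G ∘ l) 1 = xs := by simp [hl, hG0]
  have := geoDist_le_curveLength hγ hM
  rw [h0, h01] at this
  exact this.trans hlen

/-- A map of `M` that fixes `xs` and contracts velocities on a ball around `xs` contracts the
geodesic distance to `xs`, because curves shorter than the radius stay in the ball. -/
theorem geoDist_map_le {d : ℕ} {M : Set (E d)} {Φ : E d → E d} {x xs : E d} {ρ q : ℝ}
    (hq : 0 < q) (hΦM : MapsTo Φ M M) (hΦxs : Φ xs = xs)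
    (hx : geoDist M x xs < ENNReal.ofReal ρ)
    (hΦ : ∀ γ : ℝ → E d, ContDiffOn ℝ 1 γ (Icc 0 1) → MapsTo γ (Icc 0 1) M →
      (∀ t ∈ Icc (0 : ℝ) 1, ‖γ t - xs‖ < ρ) → ContDiffOn ℝ 1 (Φ ∘ γ) (Icc 0 1) ∧
      ∀ t ∈ Icc (0 : ℝ) 1,
        ‖derivWithin (Φ ∘ γ) (Icc 0 1) t‖ ≤ q * ‖derivWithin γ (Icc 0 1) t‖) :
    geoDist M (Φ x) xs ≤ ENNReal.ofReal q * geoDist M x xs := by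
  have key : ∀ γ ∈ {γ : ℝ → E d | ContDiffOn ℝ 1 γ (Icc 0 1) ∧ MapsTo γ (Icc 0 1) M ∧
      γ 0 = x ∧ γ 1 = xs}, curveLength γ < ENNReal.ofReal ρ →
      geoDist M (Φ x) xs ≤ ENNReal.ofReal q * curveLength γ := by
    rintro γ ⟨h1, h2, h3, h4⟩ hlen
    have hball : ∀ t ∈ Icc (0 : ℝ) 1, ‖γ t - xs‖ < ρ := fun t ht => by
      have h5 := (enorm_sub_le_curveLength h1 ht).trans_lt hlen
      rw [h4, ← ofReal_norm, norm_sub_rev] at h5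
      exact (ENNReal.ofReal_lt_ofReal_iff_of_nonneg (norm_nonneg _)).1 h5
    obtain ⟨h6, h7⟩ := hΦ γ h1 h2 hball
    have h8 := geoDist_le_curveLength h6 (hΦM.comp h2)
    rw [Function.comp_apply, Function.comp_apply, h3, h4, hΦxs] at h8
    exact h8.trans (curveLength_le_mul hq.le h7)
  obtain ⟨γ₀, hγ₀, hlen₀⟩ : ∃ γ₀, ∃ _ : γ₀ ∈ {γ : ℝ → E d | ContDiffOn ℝ 1 γ (Icc 0 1) ∧
      MapsTo γ (Icc 0 1) M ∧ γ 0 = x ∧ γ 1 = xs}, curveLength γ₀ < ENNReal.ofReal ρ := by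
    simpa only [geoDist, iInf_lt_iff] using hx
  have hq0 : ENNReal.ofReal q ≠ 0 := by simpa using hq
  rw [geoDist.eq_def M x xs]
  simp only [ENNReal.mul_iInf_of_ne hq0 ENNReal.ofReal_ne_top]
  refine le_iInf₂ fun γ hγ => ?_
  rcases lt_or_ge (curveLength γ) (ENNReal.ofReal ρ) with hlt | hge
  · exact key γ hγ hlt
  · exact (key γ₀ hγ₀ hlen₀).trans (by gcongr; exact hlen₀.le.trans hge)

end CSD

theorem mainTheorem3 {d m k : ℕ}
    (f : CSD.E d → ℝ) (hf : ContDiff ℝ ∞ f)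
    (c : Fin m → CSD.E d → ℝ) (hc : ∀ i, ContDiff ℝ ∞ (c i)) (hLICQ : CSD.LICQ c)
    (Ret : CSD.E d → CSD.E d → CSD.E d) (hRet : CSD.IsRetraction c Ret)
    (xs : CSD.E d) (δ μ L : ℝ) (hsaddle : CSD.IsStrictSaddle c f k xs δ μ L)
    (θ : ℝ) (hθ₀ : 0 ≤ θ) (hθ : θ < μ / (2 * L)) :
    ∃ U ∈ 𝓝[CSD.feasible c] xs,
      ∀ dt : ℝ, 0 < dt → dt ≤ 1 / L →
      ∀ (x : ℕ → CSD.E d)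
        (Q : ∀ n, CSD.tangentSpace c (x n) →L[ℝ] CSD.tangentSpace c (x n)),
        CSD.IsInexactCSD c f Ret dt x Q →
        (∀ n, ‖Q n - CSD.unstableProj c f (x n)‖ ≤ θ) →
        x 0 ∈ U →
        Tendsto x atTop (𝓝 xs) ∧
        CSD.geoDist (CSD.feasible c) (x 0) xs < ⊤ ∧
        ∀ n, CSD.geoDist (CSD.feasible c) (x (n + 1)) xs ≤
          ENNReal.ofReal (1 - dt * L * (μ / (2 * L) - θ)) *
            CSD.geoDist (CSD.feasible c) (x n) xs := by
  have hμ := hsaddle.mu_pos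
  have hL : 0 < L := hμ.trans hsaddle.mu_lt
  have hxs := hsaddle.mem
  obtain ⟨ρ, hρ, hstep⟩ :=
    CSD.exists_norm_derivWithin_stepMap_comp_le hf hc hLICQ hRet hsaddle hθ₀ hθ
  set ρ' := min ρ δ with hρ'
  have hρ'pos : 0 < ρ' := lt_min hρ hsaddle.delta_pos
  -- in this geodesic ball both the spectral hypothesis and the contraction estimate apply, and the
  -- contraction keeps the iterates inside
  refine ⟨{y | CSD.geoDist (CSD.feasible c) y xs < ENNReal.ofReal ρ'},
    CSD.eventually_geoDist_lt hc hxs (hLICQ xs hxs) (ENNReal.ofReal_pos.2 hρ'pos), ?_⟩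
  intro dt hdt hdtL x Q hx hQ hx0
  set q := 1 - dt * L * (μ / (2 * L) - θ) with hq
  have hq1 : q < 1 := by
    have : 0 < dt * L * (μ / (2 * L) - θ) := mul_pos (mul_pos hdt hL) (by linarith)
    linarith
  have hq0 : 0 < q := by
    have h1 : dt * L ≤ 1 := by rwa [le_div_iff₀ hL] at hdtL
    have h2 : μ / (2 * L) < 1 := by
      rw [div_lt_one (by positivity)]; linarith [hsaddle.mu_lt]
    have h3 : dt * L * (μ / (2 * L) - θ) ≤ 1 * (μ / (2 * L) - θ) :=
      mul_le_mul_of_nonneg_right h1 (by linarith)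
    linarith
  have hone : ∀ n, x n ∈ CSD.feasible c →
      CSD.geoDist (CSD.feasible c) (x n) xs < ENNReal.ofReal ρ' →
      CSD.geoDist (CSD.feasible c) (x (n + 1)) xs ≤
        ENNReal.ofReal q * CSD.geoDist (CSD.feasible c) (x n) xs := by
    intro n hn hlt
    have hlt1 : CSD.geoDist (CSD.feasible c) (x n) xs < ENNReal.ofReal ρ :=
      hlt.trans_le (ENNReal.ofReal_le_ofReal (min_le_left _ _))
    have hlt2 : CSD.geoDist (CSD.feasible c) (x n) xs < ENNReal.ofReal δ :=
      hlt.trans_le (ENNReal.ofReal_le_ofReal (min_le_right _ _))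
    have hnear : ‖x n - xs‖ < ρ := by
      have h5 := (CSD.enorm_sub_le_geoDist (CSD.feasible c) (x n) xs).trans_lt hlt1
      rw [← ofReal_norm] at h5
      exact (ENNReal.ofReal_lt_ofReal_iff_of_nonneg (norm_nonneg _)).1 h5
    rw [hx.2 n, ← CSD.stepMap_reflOp_self c f Ret dt (x n) (Q n)]
    refine CSD.geoDist_map_le hq0 (fun y hy => CSD.stepMap_mem hRet f dt _ hy)
      (CSD.stepMap_of_riemGrad_eq_zero hRet dt _ hxs hsaddle.critical) hlt1
      fun γ hγ hγM hγρ => ⟨CSD.contDiffOn_stepMap_comp hc hLICQ hf hRet dt _ hγ hγM, ?_⟩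
    exact hstep (x n) hn hnear hlt2 (Q n) (hQ n) dt hdt hdtL γ hγ hγM hγρ
  have hinv : ∀ n, x n ∈ CSD.feasible c ∧ CSD.geoDist (CSD.feasible c) (x n) xs ≤
      ENNReal.ofReal q ^ n * CSD.geoDist (CSD.feasible c) (x 0) xs := by
    have hqle : ENNReal.ofReal q ≤ 1 := ENNReal.ofReal_le_one.2 hq1.le
    intro n
    induction n with
    | zero => exact ⟨hx.1, by simp⟩
    | succ n ih =>
      refine ⟨?_, ?_⟩
      · rw [hx.2 n]
        exact hRet.mem _ ih.1 _ (Subtype.coe_prop _)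
      · have hlt : CSD.geoDist (CSD.feasible c) (x n) xs < ENNReal.ofReal ρ' :=
          (ih.2.trans (mul_le_of_le_one_left' (pow_le_one' hqle n))).trans_lt hx0
        calc _ ≤ _ := hone n ih.1 hlt
          _ ≤ ENNReal.ofReal q * (ENNReal.ofReal q ^ n *
              CSD.geoDist (CSD.feasible c) (x 0) xs) := by gcongr; exact ih.2
          _ = _ := by rw [pow_succ']; ring
  have hfin : CSD.geoDist (CSD.feasible c) (x 0) xs < ⊤ := hx0.trans ENNReal.ofReal_lt_top
  refine ⟨?_, hfin, fun n => hone n (hinv n).1 ?_⟩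
  · rw [tendsto_iff_edist_tendsto_0]
    have hlim : Tendsto (fun n => ENNReal.ofReal q ^ n *
        CSD.geoDist (CSD.feasible c) (x 0) xs) atTop (𝓝 0) := by
      have := ENNReal.Tendsto.mul_const (b := CSD.geoDist (CSD.feasible c) (x 0) xs)
        (ENNReal.tendsto_pow_atTop_nhds_zero_of_lt_one (ENNReal.ofReal_lt_one.2 hq1))
        (Or.inr hfin.ne)
      simpa using this
    refine tendsto_of_tendsto_of_tendsto_of_le_of_le tendsto_const_nhds hlim
      (fun _ => zero_le) fun n => ?_
    rw [edist_eq_enorm_sub]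
    exact (CSD.enorm_sub_le_geoDist _ _ _).trans (hinv n).2
  · exact ((hinv n).2.trans (mul_le_of_le_one_left'
      (pow_le_one' (ENNReal.ofReal_le_one.2 hq1.le) n))).trans_lt hx0
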